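/- Let $(\Omega,\mathcal F,\mu)$ be a $\sigma$-finite measure space, let $(E,d)$ be a complete separable metric space with a countable dense subset $G$, and let $L^0(E)$ be the set of measurable functions $\Omega\to E$ modulo almost everywhere (a.e.) equality; sets in $\mathcal F$ are likewise identified modulo null sets, and unions $\bigcup$ of families in $\mathcal F$ are suprema in the resulting complete Boolean algebra. Write $x|A$ for the restriction of $x$ to $A$, and $N|A=\{x|A : x\in N\}$ for $N\subseteq L^0(E)$ and $A\in\mathcal F$. A set $W\subseteq L^0(E)$ is *stable* if it is non-empty and, for every countable measurable partition $(A_k)$ of $\Omega$ and all $x_k\in W$, the element $x\in L^0(E)$ with $x|A_k=x_k|A_k$ for all $k$ belongs to $W$. A *conditional set* is a set $N|A$ with $N\subseteq L^0(E)$ stable and $A\in\mathcal F$. Put $$i(x,N|A):=\bigcup\{B\in\mathcal F : B\subseteq A,\ x|B\in N|B\}.$$ * The *conditional union* of a sequence $(N_k|A_k)$ is $V|C$, where $C=\bigcup_k A_k$ and $V=\{x : \bigcup_k (i(x,N_k|\Omega)\cap A_k)=C\}$. * The *conditional complement* of $N|A$ is $V|D$, where $D$ is the union of all $D'\in\mathcal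 F$ for which there is $x\in L^0(E)$ with $x|B\notin N|B$ for all $B\in\mathcal F$, $B\subseteq D'\cap A$, $\mu(B)>0$, and where $V$ is the set of all $x\in L^0(E)$ with $x|B\notin N|B$ for all $B\in\mathcal F$, $B\subseteq D\cap A$, $\mu(B)>0$. * For $q\in L^0(G)$ and $r\in L^0(\mathbb Q)$ with $r>0$ a.e., let $B(q,r)=\{x\in L^0(E) : d(x,q)<r \text{ a.e.}\}$. A conditional set is *open in $\mathcal S$* if it is the conditional union of a sequence $(B(q_k,r_k)|A_k)_{k\in\mathbb N}$ of such balls restricted to sets $A_k\in\mathcal F$. A set $W\subseteq L^0(E)$ is *closed in $\mathcal S$* if $W|\Omega$ is the conditional complement of an open conditional set. **Proposition.** Let $W\subseteq L^0(E)$ be stable. Then the following are equivalent. 1. $W$ is closed in $\mathcal S$. 2. $W$ is sequentially closed: if $x_k\in W$ for all $k\in\mathbb N$, $x\in L^0(E)$ and $x_k\to x$ a.e., then $x\in W$. 3. There is a map $X\colon\Omega\to 2^E$ with closed values that is Effros measurable, i.e. $\{\omega : X(\omega)\cap O\neq\emptyset\}\in\mathcal F$ for every open $O\subseteq E$, such that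 $W=\{x\in L^0(E) : x(\omega)\in X(\omega) \text{ for a.e. } \omega\}$. -/

import Mathlib

open MeasureTheory Filter Topology Set

namespace CondModel

variable {Ω : Type*} [MeasurableSpace Ω] {μ : Measure Ω} {E : Type*}

/-- A countable partition of `Ω` into measurable sets; members are allowed to be empty. -/
structure IsMeasurablePartition (A : ℕ → Set Ω) : Prop where
  measurable : ∀ k, MeasurableSet (A k)
  disjoint : Pairwise fun j k => Disjoint (A j) (A k)
  iUnion_eq : ⋃ k, A k = univ

/-- `U` is the union of the family `𝒢` of measurable sets in the measure algebra of `μ`, that is,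
the least upper bound of `𝒢` modulo null sets. -/
def IsEssUnion (μ : Measure Ω) (𝒢 : Set (Set Ω)) (U : Set Ω) : Prop :=
  MeasurableSet U ∧ (∀ B ∈ 𝒢, B ≤ᵐ[μ] U) ∧
    ∀ V : Set Ω, MeasurableSet V → (∀ B ∈ 𝒢, B ≤ᵐ[μ] V) → U ≤ᵐ[μ] V

section Topological

variable [TopologicalSpace E]

/-- `z = ∑ₖ xₖ|Aₖ`. -/
def IsConcatenation (x : ℕ → Ω →ₘ[μ] E) (A : ℕ → Set Ω) (z : Ω →ₘ[μ] E) : Prop :=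
  ∀ k, z =ᵐ[μ.restrict (A k)] x k

/-- Stability under countable concatenations; stable sets are nonempty. -/
def IsStable (W : Set (Ω →ₘ[μ] E)) : Prop :=
  W.Nonempty ∧ ∀ (A : ℕ → Set Ω) (x : ℕ → Ω →ₘ[μ] E), IsMeasurablePartition A →
    (∀ k, x k ∈ W) → ∀ z : Ω →ₘ[μ] E, IsConcatenation x A z → z ∈ W

/-- The restricted function `x|B` belongs to `N|B = {n|B : n ∈ N}`. -/
def RestrictMem (x : Ω →ₘ[μ] E) (N : Set (Ω →ₘ[μ] E)) (B : Set Ω) : Prop :=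
  ∃ n ∈ N, x =ᵐ[μ.restrict B] n

variable (E μ) in
/-- A representative of the conditional subset `N|A` of `L⁰(E)`, with `N = carrier` and
`A = support`. -/
structure CondSet where
  carrier : Set (Ω →ₘ[μ] E)
  support : Set Ω

/-- `N|A = M|B`. -/
def CondSet.Same (S T : CondSet μ E) : Prop :=
  S.support =ᵐ[μ] T.support ∧ (∀ n ∈ S.carrier, RestrictMem n T.carrier S.support) ∧
    ∀ m ∈ T.carrier, RestrictMem m S.carrier S.support

/-- The conditional element relation: `U = i(x, N|A)`, the union in the measure algebra of all
measurable `B ⊆ A` with `x|B ∈ N|B`. -/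
def IsTruthValue (x : Ω →ₘ[μ] E) (S : CondSet μ E) (U : Set Ω) : Prop :=
  IsEssUnion μ {B | MeasurableSet B ∧ B ⊆ S.support ∧ RestrictMem x S.carrier B} U

/-- The conditional union of `Nₖ|Aₖ`: it is `V|C` with `C = ⋃ₖ Aₖ` and
`V = {x | ⋃ₖ (i(x, Nₖ) ∩ Aₖ) = C}`, the equality being in the measure algebra. -/
def condUnion (S : ℕ → CondSet μ E) : CondSet μ E where
  carrier := {x | ∃ U : ℕ → Set Ω, (∀ k, IsTruthValue x ⟨(S k).carrier, univ⟩ (U k)) ∧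
    (⋃ k, U k ∩ (S k).support : Set Ω) =ᵐ[μ] (⋃ k, (S k).support : Set Ω)}
  support := ⋃ k, (S k).support

/-- On no non-negligible part of `D` is the restriction of `x` an element of the conditional
set. -/
def NowhereMem (x : Ω →ₘ[μ] E) (S : CondSet μ E) (D : Set Ω) : Prop :=
  ∀ B : Set Ω, MeasurableSet B → B ⊆ D ∩ S.support → 0 < μ B → ¬ RestrictMem x S.carrier B

/-- `T = V|D` is the conditional complement of `S = N|A`: `D` is the union in the measure algebra of
all measurable `D'` on which some `x` is nowhere an element of `N|A`, and `V` is the set of all `x`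
which are nowhere on `D` an element of `N|A`. -/
def IsCondCompl (S T : CondSet μ E) : Prop :=
  IsEssUnion μ {D' | MeasurableSet D' ∧ ∃ x : Ω →ₘ[μ] E, NowhereMem x S D'} T.support ∧
    T.carrier = {x | NowhereMem x S T.support}

/-- Sequential closedness under almost everywhere convergence. -/
def IsAESeqClosed (W : Set (Ω →ₘ[μ] E)) : Prop :=
  ∀ (x : ℕ → Ω →ₘ[μ] E) (z : Ω →ₘ[μ] E), (∀ k, x k ∈ W) →
    (∀ᵐ ω ∂μ, Tendsto (fun k => x k ω) atTop (𝓝 (z ω))) → z ∈ W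

/-- Effros measurability of a set-valued map. -/
def IsEffrosMeasurable (X : Ω → Set E) : Prop :=
  ∀ O : Set E, IsOpen O → MeasurableSet {ω | (X ω ∩ O).Nonempty}

variable (μ) in
/-- The set of almost everywhere selections of a set-valued map. -/
def aeSelections (X : Ω → Set E) : Set (Ω →ₘ[μ] E) :=
  {x | ∀ᵐ ω ∂μ, x ω ∈ X ω}

end Topological

section Metric

variable [MetricSpace E]

/-- The ball `B(q, r) = {x | d(x, q) < r}` with random centre and random rational radius. -/
def condBall (q : Ω →ₘ[μ] E) (r : Ω →ₘ[μ] ℚ) : Set (Ω →ₘ[μ] E) :=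
  {x | ∀ᵐ ω ∂μ, dist (x ω) (q ω) < (r ω : ℝ)}

/-- The open sets of the conditional model: conditional unions of sequences of conditional balls
`B(qₖ, rₖ)|Aₖ` with `qₖ ∈ L⁰(G)` and `rₖ ∈ L⁰(ℚ)`, `rₖ > 0`. The balls may live on a part `Aₖ` of
`Ω` only, so that the empty conditional set is open. -/
def IsCondOpen (G : Set E) (O : CondSet μ E) : Prop :=
  ∃ (q : ℕ → Ω →ₘ[μ] E) (r : ℕ → Ω →ₘ[μ] ℚ) (A : ℕ → Set Ω),
    (∀ k, ∀ᵐ ω ∂μ, q k ω ∈ G) ∧ (∀ k, ∀ᵐ ω ∂μ, 0 < r k ω) ∧ (∀ k, MeasurableSet (A k)) ∧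
      O = condUnion fun k => ⟨condBall (q k) (r k), A k⟩

/-- `W = W|Ω` is closed in the conditional model: it is the conditional complement of an open
set. -/
def IsCondClosed (G : Set E) (W : Set (Ω →ₘ[μ] E)) : Prop :=
  ∃ O T : CondSet μ E, IsCondOpen G O ∧ IsCondCompl O T ∧ T.Same ⟨W, univ⟩

end Metric

end CondModel

namespace CondModel

/-! ### Gluing along countable covers -/

section Gluing

variable {Ω : Type*} [MeasurableSpace Ω] {μ : Measure Ω} {E : Type*}
  [MetricSpace E] [TopologicalSpace.SeparableSpace E]

/-! Gluing turns each conditional notion into an a.e. pointwise one: the complement of the union of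
the balls `B(q k, r k)` on `A k` consists of the `x` with `r k ≤ dist x (q k)` a.e. on each `A k`
(`nowhereMem_condUnion_condBall_iff`). These non-strict inequalities survive a.e. limits, so 1
implies 2. For 2 ⇒ 3, exhaustion gives countably many members of `W` whose pointwise closure `X ω`
contains the values of every member a.e. Conversely, gluing these members approximates any selection
of `X`, which then lies in `W` by stability and closedness. For 3 ⇒ 1, the complement of `X ω` is
the union of the balls with centre in `G` and positive rational radius that miss `X ω`; Effros
measurability makes "ball `k` misses `X`" a measurable event `A k`. -/

theorem exists_isConcatenation (A : ℕ → Set Ω) (hA : IsMeasurablePartition A)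
    (x : ℕ → Ω →ₘ[μ] E) : ∃ z : Ω →ₘ[μ] E, IsConcatenation x A z := by
  borelize E
  have : SecondCountableTopology E := UniformSpace.secondCountable_of_separable E
  obtain ⟨f, hf, hfx⟩ := exists_measurable_piecewise A hA.measurable (fun k ω => x k ω)
    (fun k => (x k).measurable) (by
      intro i j hij ω hω
      exact absurd hω.2 (Set.disjoint_left.1 (hA.disjoint hij) hω.1))
  refine ⟨AEEqFun.mk f hf.aestronglyMeasurable, fun k => ?_⟩
  have h1 : AEEqFun.mk f hf.aestronglyMeasurable =ᵐ[μ.restrict (A k)] f :=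
    ae_restrict_of_ae (AEEqFun.coeFn_mk f _)
  exact h1.trans (ae_restrict_of_forall_mem (hA.measurable k) fun ω hω => hfx k hω)

/-- Elements of `L⁰(E)` can be glued along an arbitrary countable measurable cover, and stable sets
are closed under gluing. -/
theorem exists_glue {ι : Type*} [Countable ι] [Nonempty ι] (A : ι → Set Ω)
    (hA : ∀ i, MeasurableSet (A i)) (hcov : ∀ᵐ ω ∂μ, ∃ i, ω ∈ A i) (x : ι → Ω →ₘ[μ] E) :
    ∃ z : Ω →ₘ[μ] E, (∀ᵐ ω ∂μ, ∃ i, ω ∈ A i ∧ z ω = x i ω) ∧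
      ∀ W : Set (Ω →ₘ[μ] E), IsStable W → (∀ i, x i ∈ W) → z ∈ W := by
  obtain ⟨e, he⟩ := exists_surjective_nat ι
  -- Adding the uncovered null set to every piece makes the cover exact.
  set B : ℕ → Set Ω := fun n => A (e n) ∪ (⋃ i, A i)ᶜ with hB
  have hBm : ∀ n, MeasurableSet (B n) := fun n =>
    (hA _).union (MeasurableSet.iUnion hA).compl
  have hP : IsMeasurablePartition (disjointed B) := by
    refine ⟨fun n => MeasurableSet.disjointed hBm n, disjoint_disjointed B, ?_⟩
    rw [iUnion_disjointed, eq_univ_iff_forall]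
    intro ω
    by_cases h : ω ∈ ⋃ i, A i
    · obtain ⟨i, hi⟩ := mem_iUnion.1 h
      obtain ⟨n, rfl⟩ := he i
      exact mem_iUnion.2 ⟨n, Or.inl hi⟩
    · exact mem_iUnion.2 ⟨0, Or.inr h⟩
  obtain ⟨z, hz⟩ := exists_isConcatenation (disjointed B) hP fun n => x (e n)
  refine ⟨z, ?_, fun W hW hx => hW.2 _ _ hP (fun n => hx _) z hz⟩
  have hz' : ∀ᵐ ω ∂μ, ∀ n, ω ∈ disjointed B n → z ω = x (e n) ω :=
    ae_all_iff.2 fun n => (ae_restrict_iff' (hP.measurable n)).1 (hz n)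
  filter_upwards [hz', hcov] with ω hω hc
  obtain ⟨n, hn⟩ := mem_iUnion.1 (hP.iUnion_eq ▸ mem_univ ω : ω ∈ ⋃ k, disjointed B k)
  refine ⟨e n, ?_, hω n hn⟩
  rcases disjointed_subset B n hn with h | h
  · exact h
  · exact absurd (mem_iUnion.2 hc) h

end Gluing

/-! ### Exhaustion in the measure algebra -/

section Exhaustion

variable {Ω : Type*} [MeasurableSpace Ω]

/-- In a σ-finite measure space the union of a family of measurable sets in the measure algebra is
attained by a countable subfamily. -/
theorem exists_seq_ae_le_iUnion (μ : Measure Ω) [SigmaFinite μ] {ι : Type*} [Nonempty ι]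
    (A : ι → Set Ω) (hA : ∀ i, MeasurableSet (A i)) :
    ∃ s : ℕ → ι, ∀ i, A i ≤ᵐ[μ] (⋃ n, A (s n) : Set Ω) := by
  obtain ⟨ν, hν, hμν⟩ : ∃ ν : Measure Ω, IsFiniteMeasure ν ∧ μ ≪ ν :=
    ⟨μ.toFinite, inferInstance, absolutelyContinuous_toFinite μ⟩
  set m : (ℕ → ι) → ENNReal := fun s => ν (⋃ n, A (s n)) with hm
  obtain ⟨u, -, hlim, hu⟩ := exists_seq_tendsto_sSup (range_nonempty m) (OrderTop.bddAbove (range m))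
  choose v hv using hu
  refine ⟨fun k => v k.unpair.1 k.unpair.2, fun i => hμν.ae_le ?_⟩
  set U : Set Ω := ⋃ k : ℕ, A (v k.unpair.1 k.unpair.2) with hU
  have hsup : sSup (range m) ≤ ν U := by
    refine le_of_tendsto' hlim fun n => ?_
    rw [← hv n]
    refine measure_mono (iUnion_subset fun j ω hω => mem_iUnion.2 ⟨Nat.pair n j, ?_⟩)
    simpa using hω
  have hle : ν (A i ∪ U) ≤ ν U := by
    -- Prepending `i` to the enumeration cannot beat the supremum, which `U` already attains.
    set t : ℕ → ι := fun k => Nat.casesOn k i fun k => v k.unpair.1 k.unpair.2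
    have ht : m t ≤ sSup (range m) := le_sSup (mem_range_self t)
    refine le_trans (measure_mono ?_) (ht.trans hsup)
    refine union_subset (fun ω hω => mem_iUnion.2 ⟨0, hω⟩) (iUnion_subset fun k ω hω => ?_)
    exact mem_iUnion.2 ⟨k + 1, hω⟩
  have hUm : MeasurableSet U := MeasurableSet.iUnion fun _ => hA _
  have heq : U =ᵐ[ν] (A i ∪ U : Set Ω) := ae_eq_of_subset_of_measure_ge subset_union_right hle
    hUm.nullMeasurableSet (measure_ne_top ν _)
  exact (subset_union_left.eventuallyLE).trans heq.symm.le

end Exhaustion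

/-! ### Conditional balls and closedness, pointwise -/

section Metric

variable {Ω : Type*} [MeasurableSpace Ω] {μ : Measure Ω} {E : Type*} [MetricSpace E]

theorem measurableSet_dist_lt (x q : Ω →ₘ[μ] E) (r : Ω →ₘ[μ] ℚ) :
    MeasurableSet {ω | dist (x ω) (q ω) < (r ω : ℝ)} :=
  measurableSet_lt (x.stronglyMeasurable.dist q.stronglyMeasurable).measurable
    (Rat.continuous_coe_real.comp_stronglyMeasurable r.stronglyMeasurable).measurable

theorem IsEssUnion.ae_eq {𝒢 : Set (Set Ω)} {U V : Set Ω} (hU : IsEssUnion μ 𝒢 U)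
    (hV : IsEssUnion μ 𝒢 V) : U =ᵐ[μ] V :=
  (hU.2.2 V hV.1 hV.2.1).antisymm (hV.2.2 U hU.1 hU.2.1)

theorem mem_of_restrictMem {x : Ω →ₘ[μ] E} {N : Set (Ω →ₘ[μ] E)} {A : Set Ω}
    (h : RestrictMem x N A) (hA : A =ᵐ[μ] (univ : Set Ω)) : x ∈ N := by
  obtain ⟨n, hn, hx⟩ := h
  rw [Measure.restrict_congr_set hA, Measure.restrict_univ] at hx
  rwa [AEEqFun.ext hx]

variable [TopologicalSpace.SeparableSpace E]

/-- As `r > 0`, the centre `q` lies in the ball; replacing `x` by `q` off the event gives a member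
of the ball that agrees with `x` on it. -/
theorem isTruthValue_condBall (x q : Ω →ₘ[μ] E) {r : Ω →ₘ[μ] ℚ} (hr : ∀ᵐ ω ∂μ, 0 < r ω) :
    IsTruthValue x ⟨condBall q r, univ⟩ {ω | dist (x ω) (q ω) < (r ω : ℝ)} := by
  have hP := measurableSet_dist_lt x q r
  refine ⟨hP, ?_, fun V _ hV => hV _ ⟨hP, subset_univ _, ?_⟩⟩
  · rintro B ⟨hB, -, n, hn, hxn⟩
    filter_upwards [(ae_restrict_iff' hB).1 hxn, hn] with ω h1 h2 h3
    change dist (x ω) (q ω) < _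
    rwa [h1 h3]
  · set P := {ω | dist (x ω) (q ω) < (r ω : ℝ)}
    obtain ⟨z, hz, -⟩ := exists_glue (μ := μ) (fun b : Bool => if b then P else Pᶜ)
      (by rintro (_ | _) <;> simp [hP])
      (Eventually.of_forall fun ω => by by_cases h : ω ∈ P <;> simp [h])
      (fun b : Bool => if b then x else q)
    refine ⟨z, ?_, (ae_restrict_iff' hP).2 ?_⟩
    · filter_upwards [hz, hr] with ω hω hr
      rcases hω with ⟨_ | _, h1, h2⟩
      · simp only [Bool.false_eq_true, if_false] at h2
        rw [h2, dist_self]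
        exact_mod_cast hr
      · simp only [if_true] at h1 h2
        rw [h2]
        exact h1
    · filter_upwards [hz] with ω hω hP
      rcases hω with ⟨_ | _, h1, h2⟩
      · exact absurd hP h1
      · simpa using h2.symm

theorem mem_condUnion_condBall_iff {q : ℕ → Ω →ₘ[μ] E} {r : ℕ → Ω →ₘ[μ] ℚ}
    (hr : ∀ k, ∀ᵐ ω ∂μ, 0 < r k ω) {A : ℕ → Set Ω} {x : Ω →ₘ[μ] E} :
    x ∈ (condUnion fun k => ⟨condBall (q k) (r k), A k⟩ : CondSet μ E).carrier ↔
      ∀ᵐ ω ∂μ, ω ∈ ⋃ k, A k → ∃ k, ω ∈ A k ∧ dist (x ω) (q k ω) < (r k ω : ℝ) := by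
  constructor
  · rintro ⟨U, hU, hUA⟩
    have h : ∀ᵐ ω ∂μ, ∀ k, ω ∈ U k → dist (x ω) (q k ω) < (r k ω : ℝ) :=
      ae_all_iff.2 fun k => ((hU k).ae_eq (isTruthValue_condBall x (q k) (hr k))).le
    filter_upwards [h, hUA.symm.le] with ω h1 h2 h3
    obtain ⟨k, hk⟩ := mem_iUnion.1 (h2 h3)
    exact ⟨k, hk.2, h1 k hk.1⟩
  · intro h
    refine ⟨_, fun k => isTruthValue_condBall x (q k) (hr k), ?_⟩
    refine Filter.EventuallyLE.antisymm (Eventually.of_forall fun ω hω => ?_) ?_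
    · obtain ⟨k, hk⟩ := mem_iUnion.1 hω
      exact mem_iUnion.2 ⟨k, hk.2⟩
    · filter_upwards [h] with ω hω hA
      obtain ⟨k, hk, hd⟩ := hω hA
      exact mem_iUnion.2 ⟨k, hd, hk⟩

theorem nowhereMem_condUnion_condBall_iff {q : ℕ → Ω →ₘ[μ] E} {r : ℕ → Ω →ₘ[μ] ℚ}
    (hr : ∀ k, ∀ᵐ ω ∂μ, 0 < r k ω) {A : ℕ → Set Ω} (hA : ∀ k, MeasurableSet (A k))
    {x : Ω →ₘ[μ] E} {D : Set Ω} (hD : MeasurableSet D) :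
    NowhereMem x (condUnion fun k => ⟨condBall (q k) (r k), A k⟩) D ↔
      ∀ᵐ ω ∂μ, ω ∈ D → ∀ k, ω ∈ A k → (r k ω : ℝ) ≤ dist (x ω) (q k ω) := by
  constructor
  · intro h
    have key : ∀ k, ∀ᵐ ω ∂μ, ω ∈ D → ω ∈ A k → (r k ω : ℝ) ≤ dist (x ω) (q k ω) := by
      intro k
      set B := D ∩ A k ∩ {ω | dist (x ω) (q k ω) < (r k ω : ℝ)} with hB
      have hBm : MeasurableSet B := (hD.inter (hA k)).inter (measurableSet_dist_lt _ _ _)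
      have hB0 : μ B = 0 := by
        by_contra hne
        refine h B hBm (fun ω hω => ⟨hω.1.1, mem_iUnion.2 ⟨k, hω.1.2⟩⟩)
          (pos_iff_ne_zero.2 hne) ?_
        obtain ⟨z, hz, -⟩ := exists_glue (μ := μ)
          -- Extend `x|B` to a member of the union: take the centre `q j` on `A j \ B`, and keep `x`
          -- off `⋃ k, A k`, where nothing is required.
          (fun o : Option ℕ => o.elim (B ∪ (⋃ k, A k)ᶜ) fun j => A j \ B)
          (by
            rintro (_ | j)
            · exact hBm.union (MeasurableSet.iUnion hA).compl
            · exact (hA j).diff hBm)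
          (Eventually.of_forall fun ω => by
            by_cases hω : ω ∈ B ∪ (⋃ k, A k)ᶜ
            · exact ⟨none, hω⟩
            · simp only [mem_union, not_or, not_notMem, mem_compl_iff] at hω
              obtain ⟨j, hj⟩ := mem_iUnion.1 hω.2
              exact ⟨some j, hj, hω.1⟩)
          (fun o => o.elim x q)
        refine ⟨z, (mem_condUnion_condBall_iff hr).2 ?_, (ae_restrict_iff' hBm).2 ?_⟩
        · filter_upwards [hz, ae_all_iff.2 hr] with ω hω hr hc
          rcases hω with ⟨_ | j, h1, h2⟩
          · rcases h1 with h1 | h1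
            · refine ⟨k, h1.1.2, ?_⟩
              rw [h2]
              exact h1.2
            · exact absurd hc h1
          · refine ⟨j, h1.1, ?_⟩
            rw [h2]
            simp only [Option.elim_some, dist_self]
            exact_mod_cast hr j
        · filter_upwards [hz] with ω hω hB
          rcases hω with ⟨_ | j, h1, h2⟩
          · exact h2.symm
          · exact absurd hB h1.2
      filter_upwards [measure_eq_zero_iff_ae_notMem.1 hB0] with ω hω h1 h2
      exact not_lt.1 fun h3 => hω ⟨⟨h1, h2⟩, h3⟩
    filter_upwards [ae_all_iff.2 key] with ω hω h1 k h2 using hω k h1 h2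
  · rintro h B hB hBD hpos ⟨n, hn, hxn⟩
    refine hpos.ne' (measure_eq_zero_iff_ae_notMem.2 ?_)
    filter_upwards [h, (mem_condUnion_condBall_iff hr).1 hn, (ae_restrict_iff' hB).1 hxn]
      with ω h1 h2 h3 h4
    obtain ⟨k, hk, hd⟩ := h2 (hBD h4).2
    rw [← h3 h4] at hd
    exact (h1 (hBD h4).1 k hk).not_gt hd

theorem IsCondClosed.isAESeqClosed {G : Set E} {W : Set (Ω →ₘ[μ] E)} (h : IsCondClosed G W) :
    IsAESeqClosed W := by
  obtain ⟨_, T, ⟨q, r, A, -, hr, hA, rfl⟩, ⟨hT, hTc⟩, hTs, hTW, hWT⟩ := h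
  have hW : W = T.carrier := Subset.antisymm (fun m hm => mem_of_restrictMem (hWT m hm) hTs)
    (fun n hn => mem_of_restrictMem (hTW n hn) hTs)
  intro x z hx hz
  simp only [hW, hTc, mem_ofPred_eq, nowhereMem_condUnion_condBall_iff hr hA hT.1] at hx ⊢
  filter_upwards [ae_all_iff.2 hx, hz] with ω hω hlim hD k hk
  exact ge_of_tendsto' (hlim.dist tendsto_const_nhds) fun n => hω n hD k hk

theorem IsAESeqClosed.exists_effros [SigmaFinite μ] {W : Set (Ω →ₘ[μ] E)} (hW : IsStable W)
    (hc : IsAESeqClosed W) :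
    ∃ X : Ω → Set E, IsEffrosMeasurable X ∧ (∀ ω, IsClosed (X ω)) ∧ W = aeSelections μ X := by
  obtain ⟨w₀, hw₀⟩ := hW.1
  have : Nonempty W := ⟨⟨w₀, hw₀⟩⟩
  obtain ⟨G, hGc, hGd⟩ := TopologicalSpace.exists_countable_dense E
  have : Countable G := hGc.to_subtype
  have hmeas : ∀ (x : Ω →ₘ[μ] E) (g : E) (ρ : ℚ), MeasurableSet {ω | dist (x ω) g < (ρ : ℝ)} :=
    fun x g ρ => measurableSet_lt (x.stronglyMeasurable.dist stronglyMeasurable_const).measurable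
      measurable_const
  -- For each ball `p`, countably many members of `W` enter it wherever any given member does, up to
  -- a null set.
  choose s hs using fun p : G × ℚ => exists_seq_ae_le_iUnion μ
    (fun x : W => {ω | dist ((x : Ω →ₘ[μ] E) ω) p.1 < (p.2 : ℝ)}) fun x => hmeas x p.1 p.2
  -- The extra index `none` keeps the family nonempty even if `G` is empty.
  set c : Option ((G × ℚ) × ℕ) → Ω →ₘ[μ] E := fun o => o.elim w₀ fun p => s p.1 p.2 with hcdef
  have hcW : ∀ o, c o ∈ W := by
    rintro (_ | p)
    · exact hw₀
    · exact (s p.1 p.2).2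
  refine ⟨fun ω => closure (range fun o => c o ω), fun O hO => ?_, fun ω => isClosed_closure, ?_⟩
  · have : {ω | (closure (range fun o => c o ω) ∩ O).Nonempty} = ⋃ o, c o ⁻¹' O := by
      ext ω
      rw [mem_ofPred_eq, closure_inter_open_nonempty_iff hO]
      simp only [mem_iUnion, mem_preimage, Set.Nonempty, mem_inter_iff, mem_range]
      exact ⟨fun ⟨_, ⟨o, rfl⟩, h⟩ => ⟨o, h⟩, fun ⟨o, h⟩ => ⟨_, ⟨o, rfl⟩, h⟩⟩
    rw [this]
    borelize E
    exact MeasurableSet.iUnion fun o => (c o).measurable hO.measurableSet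
  · ext x
    constructor
    · intro hx
      have key : ∀ᵐ ω ∂μ, ∀ p : G × ℚ, dist (x ω) p.1 < (p.2 : ℝ) →
          ∃ n, dist ((s p n : Ω →ₘ[μ] E) ω) p.1 < (p.2 : ℝ) := by
        refine ae_all_iff.2 fun p => ?_
        filter_upwards [hs p ⟨x, hx⟩] with ω hω h
        obtain ⟨n, hn⟩ := mem_iUnion.1 (show ω ∈ _ from hω h)
        exact ⟨n, hn⟩
      filter_upwards [key] with ω hω
      refine Metric.mem_closure_range_iff.2 fun ε hε => ?_
      obtain ⟨ρ, hρ0, hρ⟩ := exists_rat_btwn (half_pos hε)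
      obtain ⟨g, hg, hxg⟩ := hGd.exists_dist_lt (x ω) hρ0
      obtain ⟨n, hn⟩ := hω (⟨g, hg⟩, ρ) hxg
      refine ⟨some ((⟨g, hg⟩, ρ), n), ?_⟩
      have := dist_triangle_right (x ω) (c (some ((⟨g, hg⟩, ρ), n)) ω) g
      simp only [hcdef, Option.elim_some] at this hn ⊢
      linarith
    · intro hx
      have hx : ∀ᵐ ω ∂μ, x ω ∈ closure (range fun o => c o ω) := hx
      have approx : ∀ k : ℕ, ∃ z ∈ W, ∀ᵐ ω ∂μ, dist (z ω) (x ω) < 1 / ((k : ℝ) + 1) := by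
        intro k
        obtain ⟨z, hz, hzW⟩ := exists_glue (μ := μ)
          (fun o => {ω | dist (c o ω) (x ω) < 1 / ((k : ℝ) + 1)})
          (fun o => measurableSet_lt
            ((c o).stronglyMeasurable.dist x.stronglyMeasurable).measurable measurable_const)
          (by
            filter_upwards [hx] with ω hω
            obtain ⟨o, ho⟩ := Metric.mem_closure_range_iff.1 hω _ (Nat.one_div_pos_of_nat (n := k))
            exact ⟨o, by rwa [dist_comm] at ho⟩) c
        refine ⟨z, hzW W hW hcW, ?_⟩
        filter_upwards [hz] with ω ⟨o, h1, h2⟩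
        rw [h2]
        exact h1
      choose z hzW hz using approx
      refine hc z x hzW ?_
      filter_upwards [ae_all_iff.2 hz] with ω hω
      exact tendsto_iff_dist_tendsto_zero.2 (squeeze_zero (fun _ => dist_nonneg)
        (fun k => (hω k).le) tendsto_one_div_add_atTop_nhds_zero_nat)

/-- A member of `W` avoids the open set on all of `Ω`, so the complement has full support. -/
theorem isCondClosed_of_ae_eq {G : Set E} {W : Set (Ω →ₘ[μ] E)} (hW : W.Nonempty)
    {q : ℕ → Ω →ₘ[μ] E} {r : ℕ → Ω →ₘ[μ] ℚ} {A : ℕ → Set Ω} (hq : ∀ k, ∀ᵐ ω ∂μ, q k ω ∈ G)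
    (hr : ∀ k, ∀ᵐ ω ∂μ, 0 < r k ω) (hA : ∀ k, MeasurableSet (A k))
    (h : ∀ x, x ∈ W ↔ ∀ᵐ ω ∂μ, ∀ k, ω ∈ A k → (r k ω : ℝ) ≤ dist (x ω) (q k ω)) :
    IsCondClosed G W := by
  have hmem : ∀ x, x ∈ W ↔
      NowhereMem x (condUnion fun k => ⟨condBall (q k) (r k), A k⟩) univ := fun x => by
    simp [h, nowhereMem_condUnion_condBall_iff hr hA MeasurableSet.univ]
  obtain ⟨w, hw⟩ := hW
  refine ⟨_, ⟨W, univ⟩, ⟨q, r, A, hq, hr, hA, rfl⟩, ⟨⟨MeasurableSet.univ, fun B _ => ?_,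
    fun V _ hV => hV _ ⟨MeasurableSet.univ, w, (hmem w).1 hw⟩⟩, ext hmem⟩,
    ae_eq_rfl, fun n hn => ⟨n, hn, ae_eq_rfl⟩, fun n hn => ⟨n, hn, ae_eq_rfl⟩⟩
  exact (subset_univ B).eventuallyLE

theorem IsEffrosMeasurable.isCondClosed {G : Set E} (hGc : G.Countable) (hGd : Dense G)
    {X : Ω → Set E} (hX : IsEffrosMeasurable X) (hcl : ∀ ω, IsClosed (X ω))
    (hne : (aeSelections μ X).Nonempty) : IsCondClosed G (aeSelections μ X) := by
  -- Over an empty `Ω` the set `G` may be empty too, leaving no constant centres to enumerate.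
  rcases isEmpty_or_nonempty Ω with hΩ | ⟨⟨ω₀⟩⟩
  · obtain ⟨w, hw⟩ := hne
    refine isCondClosed_of_ae_eq ⟨w, hw⟩ (q := fun _ => w) (r := fun _ => AEEqFun.const Ω 1)
      (A := fun _ => ∅) (fun _ => ?_) (fun _ => ?_) (fun _ => MeasurableSet.empty) fun x => ?_
    all_goals simp [aeSelections, Measure.eq_zero_of_isEmpty μ]
  · have : Countable G := hGc.to_subtype
    have : Nonempty G := by
      have : Nonempty E := ⟨hne.some ω₀⟩
      exact hGd.nonempty.to_subtype
    have : Nonempty {ρ : ℚ // 0 < ρ} := ⟨⟨1, one_pos⟩⟩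
    obtain ⟨e, he⟩ := exists_surjective_nat (G × {ρ : ℚ // 0 < ρ})
    have hr : ∀ k, AEEqFun.const (μ := μ) Ω ((e k).2 : ℚ) =ᵐ[μ] fun _ => ((e k).2 : ℚ) :=
      fun k => AEEqFun.coeFn_const _ _
    have hq : ∀ k, AEEqFun.const (μ := μ) Ω ((e k).1 : E) =ᵐ[μ] fun _ => ((e k).1 : E) :=
      fun k => AEEqFun.coeFn_const _ _
    refine isCondClosed_of_ae_eq hne (q := fun k => AEEqFun.const Ω ((e k).1 : E))
      (r := fun k => AEEqFun.const Ω ((e k).2 : ℚ))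
      (A := fun k => {ω | (X ω ∩ Metric.ball ((e k).1 : E) ((e k).2 : ℚ)).Nonempty}ᶜ)
      (fun k => ?_) (fun k => ?_) (fun k => (hX _ Metric.isOpen_ball).compl) fun x => ?_
    · filter_upwards [hq k] with ω hω
      rw [hω]
      exact (e k).1.2
    · filter_upwards [hr k] with ω hω
      rw [hω]
      exact (e k).2.2
    · change (∀ᵐ ω ∂μ, x ω ∈ X ω) ↔ _
      refine eventually_congr ?_
      filter_upwards [ae_all_iff.2 hr, ae_all_iff.2 hq] with ω h1 h2
      simp only [h1, h2]
      constructor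
      · intro hx k hk
        by_contra! hlt
        exact hk ⟨x ω, hx, hlt⟩
      · intro h
        by_contra hx
        -- A ball of radius `ρ < ε / 2` that contains `x ω` lies within `ε` of `x ω`, hence misses
        -- `X ω`.
        obtain ⟨ε, hε, hball⟩ := Metric.isOpen_iff.1 (hcl ω).isOpen_compl (x ω) hx
        obtain ⟨ρ, hρ0, hρ⟩ := exists_rat_btwn (half_pos hε)
        obtain ⟨g, hg, hxg⟩ := hGd.exists_dist_lt (x ω) hρ0
        obtain ⟨k, hk⟩ := he (⟨g, hg⟩, ⟨ρ, by exact_mod_cast hρ0⟩)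
        have hh := h k
        rw [hk] at hh
        refine (hh ?_).not_gt hxg
        rintro ⟨y, hy, hyg⟩
        refine hball ?_ hy
        rw [Metric.mem_ball] at hyg ⊢
        have := dist_triangle_right y (x ω) g
        simp only at hyg
        linarith

end Metric

end CondModel

theorem mainTheorem10 {Ω : Type*} [MeasurableSpace Ω] (μ : Measure Ω) [SigmaFinite μ]
    {E : Type*} [MetricSpace E] [CompleteSpace E] [TopologicalSpace.SeparableSpace E]
    (G : Set E) (hGc : G.Countable) (hGd : Dense G)
    (W : Set (Ω →ₘ[μ] E)) (hW : CondModel.IsStable W) :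
    List.TFAE [
      CondModel.IsCondClosed G W,
      CondModel.IsAESeqClosed W,
      ∃ X : Ω → Set E, CondModel.IsEffrosMeasurable X ∧ (∀ ω, IsClosed (X ω)) ∧
        W = CondModel.aeSelections μ X] := by
  tfae_have 1 → 2 := fun h => h.isAESeqClosed
  tfae_have 2 → 3 := fun h => h.exists_effros hW
  tfae_have 3 → 1 := by
    rintro ⟨X, hX, hcl, rfl⟩
    exact hX.isCondClosed hGc hGd hcl hW.1
  tfae_finish
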